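/- **Setting.** A stream of rows $a_1,a_2,\dots\in\mathbb R^d$ is distributed over $m$ sites, each row arriving at one site; the stream and the assignment are fixed in advance. Let $N$ be the number of rows that have arrived at the time of the query, let $A$ be the $N\times d$ matrix of these rows, let $w_n=\|a_n\|^2$, and suppose that $1\le w_n\le\beta$ for $n\le N$. Let $r_1,r_2,\dots$ be independent uniform random variables on $(0,1)$, and let $\rho_n=w_n/r_n$ be the priority of row $n$. **Protocol 3** (with sample-size parameter $s$). Sites and coordinator share a threshold $\tau$, initially $1$; the coordinator keeps two sets (queues) $Q$ and $Q'$, initially empty. When row $n$ arrives at a site, the site sends $(a_n,w_n,\rho_n)$ to the coordinator if and only if $\rho_n\ge\tau$. The coordinator puts a received item into $Q'$ if $\rho_n\ge2\tau$ and into $Q$ otherwise. If now $|Q'|\ge s$, the round ends: $\tau$ is doubled and broadcast to all $m$ sites, $Q$ is discarded, and the items of the old $Q'$ are split between the new $Q'$ (those with $\rho_n\ge2\tau$ for the new $\tau$) and the new $Q$ (the others). Each item sent to the coordinator is one message, and each broadcast is $m$ messages. Let $S'=Q\cup Q'$ at the time of the query. If $|S'|\ge s$, let $\hat\rho$ be the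 smallest priority in $S'$; the matrix $B$ stacks the rows of $S'$ other than the one of priority $\hat\rho$, each row $a_i$ multiplied by $\sqrt{\max(w_i,\hat\rho)/w_i}$ (so rows with $\|a_i\|^2\ge\hat\rho$ are kept as they are, and the others are rescaled to squared norm $\hat\rho$). If $|S'|<s$ (then almost surely $N<s$ and the coordinator holds the whole stream), $B$ stacks the rows of $S'$ unchanged. **Theorem 5.** There are absolute constants $C_0,C,c>0$ such that the following holds for all $0<\varepsilon\le1$, all integers $s\ge C_0\,\varepsilon^{-2}\max\{1,\log(1/\varepsilon)\}$ (so $s=\Theta(\varepsilon^{-2}\log(1/\varepsilon))$, as $\varepsilon\to0$, suffices), and all $m,d,N,\beta$ and streams as above. 1. With probability at least $1-e^{-cs}$, Protocol 3 has used at most $C\,(m+s)\max\{1,\log(\beta N/s)\}$ messages by the time of the query. 2. For every fixed unit vector $x\in\mathbb R^d$, with probability at least $1-1/s$, both this bound on the number of messages and $$\bigl|\,\|Ax\|^2-\|Bx\|^2\,\bigr|\le\varepsilon\|A\|_F^2$$ hold. (In $\max\{1,\log(\beta N/s)\}$ the logarithm is read as $0$ if $N=0$.) -/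

import Mathlib

open MeasureTheory ProbabilityTheory
open scoped Matrix Matrix.Norms.Frobenius

noncomputable section

namespace PrioritySampling

/-- The global state of the distributed system with `m` sites and one coordinator.
A triple (row, weight, priority) that the coordinator stores is represented by the arrival index
of the row in the stream. -/
structure State (m : ℕ) where
  /-- the threshold stored at each site (the last one broadcast to it) -/
  siteTau : Fin m → ℝ
  /-- the threshold `τ_j` of the current round, at the coordinator -/
  tau : ℝ
  /-- the queue `Q_j` of the current round -/
  lo : Finset ℕ
  /-- the queue `Q_{j+1}` of the next round -/
  hi : Finset ℕ
  /-- the number of messages sent so far, in both directions -/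
  messages : ℕ

/-- The priority `‖a_n‖² / r_n` of the `n`-th row; the weight of a row is its squared norm. -/
def priority {d : ℕ} (a : ℕ → EuclideanSpace ℝ (Fin d)) (r : ℕ → ℝ) (n : ℕ) : ℝ :=
  ‖a n‖ ^ 2 / r n

/-- Before the first arrival all thresholds are `1` and the queues are empty. -/
def initState (m : ℕ) : State m where
  siteTau := fun _ => 1
  tau := 1
  lo := ∅
  hi := ∅
  messages := 0

/-- The coordinator receives item `n`, which costs one message, and puts it into one of its
two queues. -/
def enqueue {m : ℕ} (ρ : ℕ → ℝ) (n : ℕ) (σ : State m) : State m :=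
  if 2 * σ.tau ≤ ρ n then
    { σ with hi := insert n σ.hi, messages := σ.messages + 1 }
  else
    { σ with lo := insert n σ.lo, messages := σ.messages + 1 }

/-- The end of a round: the coordinator doubles the threshold, broadcasts it to the `m` sites
(one message to each of them), discards the lower queue, and splits the upper queue at twice the
new threshold. -/
def nextRound {m : ℕ} (ρ : ℕ → ℝ) (σ : State m) : State m where
  siteTau := fun _ => 2 * σ.tau
  tau := 2 * σ.tau
  lo := σ.hi.filter fun i => ρ i < 2 * (2 * σ.tau)
  hi := σ.hi.filter fun i => 2 * (2 * σ.tau) ≤ ρ i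
  messages := σ.messages + m

/-- The coordinator's reaction to an incoming item: store it, and end the round if the upper queue
now has at least `s` items. -/
def receive {m : ℕ} (s : ℕ) (ρ : ℕ → ℝ) (n : ℕ) (σ : State m) : State m :=
  if s ≤ (enqueue ρ n σ).hi.card then nextRound ρ (enqueue ρ n σ) else enqueue ρ n σ

/-- Arrival of item `n` at site `i`: the site sends it to the coordinator exactly if its priority
reaches the threshold known to the site. -/
def step {m : ℕ} (s : ℕ) (ρ : ℕ → ℝ) (n : ℕ) (i : Fin m) (σ : State m) : State m :=
  if σ.siteTau i ≤ ρ n then receive s ρ n σ else σ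

/-- The state of the system after the first `N` arrivals (items `0, …, N - 1`), where item `n` has
priority `ρ n` and arrives at site `site n`. -/
def run {m : ℕ} (s : ℕ) (site : ℕ → Fin m) (ρ : ℕ → ℝ) : ℕ → State m
  | 0 => initState m
  | n + 1 => step s ρ n (site n) (run s site ρ n)

/-- All items held by the coordinator, `S' = Q_j ∪ Q_{j+1}`. -/
def State.sample {m : ℕ} (σ : State m) : Finset ℕ := σ.lo ∪ σ.hi

/-- The smallest priority `ρ̂` in a set of items (`0` for the empty set). -/
def minPriority (ρ : ℕ → ℝ) (T : Finset ℕ) : ℝ :=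
  if h : T.Nonempty then T.inf' h ρ else 0

/-- The rows that the coordinator stacks. If it holds at least `s` items, it leaves out the one of
smallest priority (priorities of different rows are almost surely different). If it holds fewer than
`s` items, then no round has ended, it holds the whole stream, and it uses all of it. -/
def kept (s : ℕ) (ρ : ℕ → ℝ) (T : Finset ℕ) : Finset ℕ :=
  if T.card < s then T else T.filter fun i => minPriority ρ T < ρ i

/-- The factor by which a stacked row of weight `w` is multiplied. A row with `w ≥ ρ̂` is kept as it
is and a lighter one is rescaled to squared norm `ρ̂`, that is, the squared norm becomes
`max w ρ̂`. If the coordinator holds fewer than `s` items (the whole stream), nothing is rescaled. -/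
def scale (s : ℕ) (ρ : ℕ → ℝ) (T : Finset ℕ) (w : ℝ) : ℝ :=
  if T.card < s then 1 else Real.sqrt (max w (minPriority ρ T) / w)

/-- The matrix `B` that the coordinator forms from the set `T` of items that it holds. -/
def estimate {d : ℕ} (s : ℕ) (a : ℕ → EuclideanSpace ℝ (Fin d)) (ρ : ℕ → ℝ) (T : Finset ℕ) :
    Matrix {i // i ∈ kept s ρ T} (Fin d) ℝ :=
  Matrix.of fun i j => scale s ρ T (‖a i‖ ^ 2) * a i j

/-- The matrix `A` of the first `N` rows of the stream. -/
def streamMatrix {d : ℕ} (a : ℕ → EuclideanSpace ℝ (Fin d)) (N : ℕ) :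
    Matrix (Fin N) (Fin d) ℝ :=
  Matrix.of fun i j => a i j

/-- `‖M x‖²` in the Euclidean norm. -/
def sqNormMulVec {ι : Type} [Fintype ι] {d : ℕ} (M : Matrix ι (Fin d) ℝ)
    (x : EuclideanSpace ℝ (Fin d)) : ℝ :=
  ‖WithLp.toLp 2 (M *ᵥ x.ofLp)‖ ^ 2

/-- The number of messages sent up to time `N`, with random numbers `r`. -/
def messageCount {m d : ℕ} (s : ℕ) (a : ℕ → EuclideanSpace ℝ (Fin d)) (site : ℕ → Fin m)
    (r : ℕ → ℝ) (N : ℕ) : ℕ :=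
  (run s site (priority a r) N).messages

/-- The matrix `B` of the coordinator at time `N`, with random numbers `r`. -/
def coordMatrix {m d : ℕ} (s : ℕ) (a : ℕ → EuclideanSpace ℝ (Fin d)) (site : ℕ → Fin m)
    (r : ℕ → ℝ) (N : ℕ) :
    Matrix {i // i ∈ kept s (priority a r) (run s site (priority a r) N).sample} (Fin d) ℝ :=
  estimate s a (priority a r) (run s site (priority a r) N).sample

end PrioritySampling

end

noncomputable section

namespace PrioritySampling

/-! The state depends on the past only through the number `J` of ended rounds: by `run_eq` the
queues are the items so far with priority in `[2^J, 2^(J+1))` and in `[2^(J+1), ∞)`. So the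
coordinator holds every item of priority at least `2^J`, and once it holds `s` items, `‖Bx‖²` is
exactly `estAt` at the threshold `ρ̂`.

Accuracy: at a deterministic threshold `t`, a row of weight `w` survives with probability `min 1
(w/t)` and is weighted by `max 1 (t/w)`, so `estAt` is an unbiased sum of independent terms and
Bernstein's inequality applies (`tail_abs_estAt`). Since `ρ̂` is random, accuracy is proved
simultaneously for all `t ≤ t₀ = 2W/s`, where `W = ‖A‖_F²`. A geometric grid suffices
(`abs_estAt_sub_le_of_grid`), and its failure probabilities have a geometric sum (`tail_grid`). With
high probability fewer than `s` items exceed `t₀` (`tail_card_priority_gt`), which forces `ρ̂ ≤ t₀`.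

Messages: the same event gives `2^J ≤ t₀` if `J ≠ 0`, so `J` is logarithmic. The upper queue
receives at most `s` arrivals per round (`hiSends_le`). An item that reaches `τ` reaches `2τ` with
conditional probability at least `1/2`, so a supermartingale bounds the lower-queue arrivals by
about twice the upper ones (`tail_loSends`). -/

/-! ### Deterministic analysis of the protocol. -/

/-- The number of items among the first `n` whose priority is at least `t`. -/
def countGE (ρ : ℕ → ℝ) (n : ℕ) (t : ℝ) : ℕ :=
  ((Finset.range n).filter fun i => t ≤ ρ i).card

/-- The number of completed rounds after `n` arrivals. -/
def rounds (s : ℕ) (ρ : ℕ → ℝ) : ℕ → ℕ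
  | 0 => 0
  | n + 1 =>
    -- The coordinator tests the upper queue only on receiving an item, hence the first condition.
    if (2 : ℝ) ^ rounds s ρ n ≤ ρ n ∧ s ≤ countGE ρ (n + 1) (2 ^ (rounds s ρ n + 1)) then
      rounds s ρ n + 1
    else rounds s ρ n

/-- The number of items that entered the upper queue on arrival. -/
def hiSends (s : ℕ) (ρ : ℕ → ℝ) : ℕ → ℕ
  | 0 => 0
  | n + 1 => hiSends s ρ n + if (2 : ℝ) ^ (rounds s ρ n + 1) ≤ ρ n then 1 else 0

/-- The number of items that entered the lower queue on arrival. -/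
def loSends (s : ℕ) (ρ : ℕ → ℝ) : ℕ → ℕ
  | 0 => 0
  | n + 1 => loSends s ρ n +
      if (2 : ℝ) ^ rounds s ρ n ≤ ρ n ∧ ρ n < (2 : ℝ) ^ (rounds s ρ n + 1) then 1 else 0

theorem countGE_mono (ρ : ℕ → ℝ) (t : ℝ) (n : ℕ) : countGE ρ n t ≤ countGE ρ (n + 1) t :=
  Finset.card_le_card fun i hi => by
    simp only [Finset.mem_filter, Finset.mem_range] at hi ⊢
    exact ⟨by omega, hi.2⟩

theorem countGE_succ (ρ : ℕ → ℝ) (t : ℝ) (n : ℕ) :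
    countGE ρ (n + 1) t = countGE ρ n t + if t ≤ ρ n then 1 else 0 := by
  unfold countGE
  rw [Finset.range_add_one, Finset.filter_insert]
  split_ifs with h
  · rw [Finset.card_insert_of_notMem (by simp)]
  · simp

theorem two_pow_rounds_le (x : ℝ) (j : ℕ) (h : (2 : ℝ) ^ (j + 1) ≤ x) : (2 : ℝ) ^ j ≤ x :=
  (pow_le_pow_right₀ one_le_two (Nat.le_succ j)).trans h

/-- The state after `n` arrivals, `j` completed rounds and `c` messages. -/
def closedState (m : ℕ) (ρ : ℕ → ℝ) (n j c : ℕ) : State m where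
  siteTau := fun _ => 2 ^ j
  tau := 2 ^ j
  lo := (Finset.range n).filter fun i => (2 : ℝ) ^ j ≤ ρ i ∧ ρ i < 2 ^ (j + 1)
  hi := (Finset.range n).filter fun i => (2 : ℝ) ^ (j + 1) ≤ ρ i
  messages := c

theorem enqueue_closedState {m : ℕ} (ρ : ℕ → ℝ) (n j c : ℕ) (h : (2 : ℝ) ^ j ≤ ρ n) :
    enqueue ρ n (closedState m ρ n j c) = closedState m ρ (n + 1) j (c + 1) := by
  have e : (2 : ℝ) * 2 ^ j = 2 ^ (j + 1) := by ring
  unfold enqueue closedState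
  simp only [e, Finset.range_add_one, Finset.filter_insert]
  by_cases h2 : (2 : ℝ) ^ (j + 1) ≤ ρ n
  · simp [h2, not_lt.2 h2]
  · simp [h, h2, not_le.1 h2]

theorem nextRound_closedState {m : ℕ} (ρ : ℕ → ℝ) (n j c : ℕ) :
    nextRound ρ (closedState m ρ n j c) = closedState m ρ n (j + 1) (c + m) := by
  have e : (2 : ℝ) * 2 ^ j = 2 ^ (j + 1) := by ring
  have e' : (2 : ℝ) * 2 ^ (j + 1) = 2 ^ (j + 1 + 1) := by ring
  unfold nextRound closedState
  simp only [e, e', Finset.filter_filter, State.mk.injEq, true_and, and_true]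
  refine Finset.filter_congr fun i _ => ⟨fun h => h.2, fun h => ⟨two_pow_rounds_le _ _ h, h⟩⟩

/-- The state of the system in closed form. -/
theorem run_eq {m : ℕ} (s : ℕ) (site : ℕ → Fin m) (ρ : ℕ → ℝ) (n : ℕ) :
    run s site ρ n = closedState m ρ n (rounds s ρ n)
      (m * rounds s ρ n + hiSends s ρ n + loSends s ρ n) := by
  induction n with
  | zero => simp [run, initState, rounds, hiSends, loSends, closedState]
  | succ n ih =>
    rw [run, ih, rounds, hiSends, loSends]
    set j := rounds s ρ n
    unfold step
    change (if (2 : ℝ) ^ j ≤ ρ n then _ else _) = _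
    by_cases h1 : (2 : ℝ) ^ j ≤ ρ n
    · rw [if_pos h1, receive, enqueue_closedState _ _ _ _ h1, nextRound_closedState]
      change (if s ≤ countGE ρ (n + 1) (2 ^ (j + 1)) then _ else _) = _
      have hc : (if (2 : ℝ) ^ (j + 1) ≤ ρ n then 1 else 0) +
          (if (2 : ℝ) ^ j ≤ ρ n ∧ ρ n < (2 : ℝ) ^ (j + 1) then 1 else 0) = 1 := by
        by_cases h2 : (2 : ℝ) ^ (j + 1) ≤ ρ n
        · simp [h2, not_lt.2 h2]
        · simp [h1, h2, not_le.1 h2]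
      by_cases h4 : s ≤ countGE ρ (n + 1) (2 ^ (j + 1))
      · rw [if_pos h4, if_pos ⟨h1, h4⟩]
        congr 1
        linarith
      · rw [if_neg h4, if_neg (fun h => h4 h.2)]
        congr 1
        linarith
    · have h2 : ¬ (2 : ℝ) ^ (j + 1) ≤ ρ n := fun h => h1 (two_pow_rounds_le _ _ h)
      rw [if_neg h1]
      simp only [h1, h2, false_and, if_false, add_zero]
      unfold closedState
      simp [Finset.range_add_one, Finset.filter_insert, h1, h2]

theorem sample_run {m : ℕ} (s : ℕ) (site : ℕ → Fin m) (ρ : ℕ → ℝ) (n : ℕ) :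
    (run s site ρ n).sample = (Finset.range n).filter fun i => (2 : ℝ) ^ rounds s ρ n ≤ ρ i := by
  rw [run_eq]
  ext i
  simp only [State.sample, closedState, Finset.mem_union, Finset.mem_filter]
  have := two_pow_rounds_le (ρ i) (rounds s ρ n)
  grind

theorem messages_run {m : ℕ} (s : ℕ) (site : ℕ → Fin m) (ρ : ℕ → ℝ) (n : ℕ) :
    (run s site ρ n).messages = m * rounds s ρ n + hiSends s ρ n + loSends s ρ n := by
  rw [run_eq, closedState]

theorem rounds_le (s : ℕ) (ρ : ℕ → ℝ) (n : ℕ) : rounds s ρ n ≤ n := by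
  induction n with
  | zero => simp [rounds]
  | succ n ih => rw [rounds]; split_ifs <;> omega

/-- If a round has ended, then at least `s` items reach the current threshold. -/
theorem le_countGE_of_rounds_ne_zero (s : ℕ) (ρ : ℕ → ℝ) (n : ℕ) (h : rounds s ρ n ≠ 0) :
    s ≤ countGE ρ n (2 ^ rounds s ρ n) := by
  induction n with
  | zero => simp [rounds] at h
  | succ n ih =>
    rw [rounds] at h ⊢
    split_ifs at h ⊢ with h1
    · exact h1.2
    · exact (ih h).trans (countGE_mono _ _ _)

/-- In each round at most `s` arriving items enter the upper queue. -/
theorem hiSends_le (s : ℕ) (hs : 1 ≤ s) (ρ : ℕ → ℝ) (n : ℕ) :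
    hiSends s ρ n ≤ s * (rounds s ρ n + 1) := by
  -- The first alternative covers the time just after a round has ended: the new upper queue may
  -- already hold `s` items, and then the next received item ends another round.
  have key : hiSends s ρ n ≤ s * rounds s ρ n ∨
      (hiSends s ρ n ≤ s * rounds s ρ n + countGE ρ n (2 ^ (rounds s ρ n + 1)) ∧
        countGE ρ n (2 ^ (rounds s ρ n + 1)) < s) := by
    induction n with
    | zero => left; simp [hiSends]
    | succ n ih =>
      rw [hiSends, rounds]
      generalize rounds s ρ n = j at *
      have hc := countGE_succ ρ (2 ^ (j + 1)) n
      have e : s * (j + 1) = s * j + s := by ring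
      by_cases h2 : (2 : ℝ) ^ (j + 1) ≤ ρ n
      · have h1 := two_pow_rounds_le _ _ h2
        simp only [h2, if_true] at hc ⊢
        split_ifs with h3
        · left; omega
        · have : ¬ s ≤ countGE ρ (n + 1) (2 ^ (j + 1)) := fun h => h3 ⟨h1, h⟩
          omega
      · simp only [h2, if_false] at hc ⊢
        split_ifs with h3
        · left; omega
        · omega
  have e : s * (rounds s ρ n + 1) = s * rounds s ρ n + s := by ring
  omega

/-! ### Distribution of a single priority. -/

section Uniform

variable {Ω : Type*} [MeasurableSpace Ω] {P : Measure Ω} {u : Ω → ℝ}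

theorem map_eq_restrict_of_isUniform (hu : pdf.IsUniform u (Set.Ioo (0 : ℝ) 1) P volume) :
    Measure.map u P = volume.restrict (Set.Ioo (0 : ℝ) 1) := by
  have h := hu
  unfold pdf.IsUniform ProbabilityTheory.cond at h
  rw [h]
  simp

theorem ae_mem_Ioo_of_isUniform (hm : Measurable u)
    (hu : pdf.IsUniform u (Set.Ioo (0 : ℝ) 1) P volume) : ∀ᵐ ω ∂P, u ω ∈ Set.Ioo (0 : ℝ) 1 := by
  have h : ∀ᵐ x ∂(Measure.map u P), x ∈ Set.Ioo (0 : ℝ) 1 := by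
    rw [map_eq_restrict_of_isUniform hu]
    exact ae_restrict_mem measurableSet_Ioo
  exact ae_of_ae_map hm.aemeasurable h

theorem measureReal_priority_gt (hm : Measurable u)
    (hu : pdf.IsUniform u (Set.Ioo (0 : ℝ) 1) P volume) {w t : ℝ} (hw : 0 < w) (ht : 0 < t) :
    P.real {ω | t < w / u ω} = min 1 (w / t) := by
  have hS : MeasurableSet {x : ℝ | t < w / x} :=
    measurableSet_lt measurable_const (measurable_const.div measurable_id)
  have h1 : P {ω | t < w / u ω} = Measure.map u P {x : ℝ | t < w / x} :=
    (Measure.map_apply hm hS).symm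
  have h2 : {x : ℝ | t < w / x} ∩ Set.Ioo (0 : ℝ) 1 = Set.Ioo 0 (min 1 (w / t)) := by
    ext x
    simp only [Set.mem_inter_iff, Set.mem_ofPred_eq, Set.mem_Ioo, lt_min_iff]
    constructor
    · rintro ⟨h, h0, h1⟩
      exact ⟨h0, h1, by rwa [lt_div_iff₀ ht, mul_comm, ← lt_div_iff₀ h0]⟩
    · rintro ⟨h0, h1, h⟩
      exact ⟨by rwa [lt_div_iff₀ h0, mul_comm, ← lt_div_iff₀ ht], h0, h1⟩
  rw [Measure.real, h1, map_eq_restrict_of_isUniform hu, Measure.restrict_apply hS, h2,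
    Real.volume_Ioo, sub_zero, ENNReal.toReal_ofReal (by positivity)]

theorem measureReal_priority_ge (hm : Measurable u)
    (hu : pdf.IsUniform u (Set.Ioo (0 : ℝ) 1) P volume) {w t : ℝ} (hw : 0 < w) (ht : 0 < t) :
    P.real {ω | t ≤ w / u ω} = min 1 (w / t) := by
  have hS : MeasurableSet {x : ℝ | t ≤ w / x} :=
    measurableSet_le measurable_const (measurable_const.div measurable_id)
  have h1 : P {ω | t ≤ w / u ω} = Measure.map u P {x : ℝ | t ≤ w / x} :=
    (Measure.map_apply hm hS).symm
  have h2 : {x : ℝ | t ≤ w / x} ∩ Set.Ioo (0 : ℝ) 1 = Set.Ioc 0 (w / t) ∩ Set.Iio 1 := by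
    ext x
    simp only [Set.mem_inter_iff, Set.mem_ofPred_eq, Set.mem_Ioo, Set.mem_Ioc, Set.mem_Iio]
    constructor
    · rintro ⟨h, h0, h1⟩
      exact ⟨⟨h0, by rwa [le_div_iff₀ ht, mul_comm, ← le_div_iff₀ h0]⟩, h1⟩
    · rintro ⟨⟨h0, h⟩, h1⟩
      exact ⟨by rwa [le_div_iff₀ h0, mul_comm, ← le_div_iff₀ ht], h0, h1⟩
  have h3 : volume (Set.Ioc 0 (w / t) ∩ Set.Iio 1) = ENNReal.ofReal (min 1 (w / t)) := by
    apply le_antisymm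
    · refine (measure_mono (t := Set.Ioc 0 (min 1 (w / t))) ?_).trans (by simp)
      rintro x ⟨⟨h0, h⟩, h1⟩
      exact ⟨h0, le_min (le_of_lt h1) h⟩
    · refine le_trans (by simp) (measure_mono (s := Set.Ioo 0 (min 1 (w / t))) ?_)
      rintro x ⟨h0, h⟩
      exact ⟨⟨h0, (h.trans_le (min_le_right _ _)).le⟩, h.trans_le (min_le_left _ _)⟩
  rw [Measure.real, h1, map_eq_restrict_of_isUniform hu, Measure.restrict_apply hS, h2, h3,
    ENNReal.toReal_ofReal (by positivity)]

end Uniform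

/-! ### Bernstein's inequality at a fixed threshold. -/

/-- The estimate of `∑ y i` from the items of priority greater than `t`. -/
def estAt (w y ρ : ℕ → ℝ) (N : ℕ) (t : ℝ) : ℝ :=
  ∑ i ∈ Finset.range N, if t < ρ i then y i * max 1 (t / w i) else 0

/-- `exp` is at most quadratic near zero. -/
theorem exp_le_one_add_add_sq {z : ℝ} (hz : |z| ≤ 1) : Real.exp z ≤ 1 + z + z ^ 2 := by
  have := (abs_le.1 (Real.abs_exp_sub_one_sub_id_le hz)).2
  linarith

/-- The two-point exponential moment bound behind Bernstein's inequality. -/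
theorem two_point_exp_moment_le {w y t l : ℝ} (hw : 0 < w) (ht : 0 < t) (hy : 0 ≤ y) (hyw : y ≤ w)
    (hl : |l| * t ≤ 1) :
    Real.exp (l * (0 - y)) + min 1 (w / t) *
      (Real.exp (l * (y * max 1 (t / w) - y)) - Real.exp (l * (0 - y))) ≤
      Real.exp (l ^ 2 * (t * w)) := by
  -- For `t ≤ w` the item is kept almost surely and unscaled, so the centred term vanishes.
  rcases le_total t w with h | h
  · have h1 : 1 ≤ w / t := (one_le_div ht).2 h
    have h2 : t / w ≤ 1 := (div_le_one hw).2 h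
    rw [min_eq_left h1, max_eq_left h2]
    simp only [mul_one, sub_self, mul_zero, Real.exp_zero]
    have := Real.one_le_exp (show 0 ≤ l ^ 2 * (t * w) by positivity)
    linarith
  · have h1 : w / t ≤ 1 := (div_le_one ht).2 h
    have h2 : 1 ≤ t / w := (one_le_div hw).2 h
    rw [min_eq_right h1, max_eq_right h2]
    have hyt : y * (t / w) ≤ t := by
      rw [mul_div_assoc', div_le_iff₀ hw]; nlinarith
    have hy2 : y ≤ y * (t / w) := by nlinarith
    have hz1 : |l * (0 - y)| ≤ 1 := by
      rw [abs_mul, zero_sub, abs_neg, abs_of_nonneg hy]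
      exact (mul_le_mul_of_nonneg_left (hyw.trans h) (abs_nonneg l)).trans hl
    have hz2 : |l * (y * (t / w) - y)| ≤ 1 := by
      rw [abs_mul, abs_of_nonneg (sub_nonneg.2 hy2)]
      exact (mul_le_mul_of_nonneg_left (by linarith) (abs_nonneg l)).trans hl
    have e1 := exp_le_one_add_add_sq hz1
    have e2 := exp_le_one_add_add_sq hz2
    have hp : 0 ≤ w / t := by positivity
    have e3 := mul_le_mul_of_nonneg_left e1 (sub_nonneg.2 h1)
    have e4 := mul_le_mul_of_nonneg_left e2 hp
    have e5 := Real.add_one_le_exp (l ^ 2 * (t * w))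
    -- The linear terms cancel because the term has mean zero; its variance `y² (t/w - 1)` is at
    -- most `t w` since `y ≤ w`.
    have e6 : (1 - w / t) * (1 + l * (0 - y) + (l * (0 - y)) ^ 2) +
        w / t * (1 + l * (y * (t / w) - y) + (l * (y * (t / w) - y)) ^ 2) =
        1 + l ^ 2 * (y * y * (t / w) - y ^ 2) := by
      field_simp
      ring
    have e7 : l ^ 2 * (y * y * (t / w) - y ^ 2) ≤ l ^ 2 * (t * w) := by
      apply mul_le_mul_of_nonneg_left _ (sq_nonneg l)
      have : y * y * (t / w) ≤ t * w := by
        rw [mul_div_assoc', div_le_iff₀ hw]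
        have := mul_le_mul hyw hyw hy hw.le
        nlinarith
      nlinarith [sq_nonneg y]
    nlinarith

section Tail

variable {Ω : Type*} [MeasurableSpace Ω] {P : Measure Ω} [IsProbabilityMeasure P] {r : ℕ → Ω → ℝ}

theorem integrable_exp_ite {A : Set Ω} [DecidablePred (· ∈ A)] (hA : MeasurableSet A) (b c l : ℝ) :
    Integrable (fun ω => Real.exp (l * ((if ω ∈ A then b else 0) - c))) P := by
  have : (fun ω => Real.exp (l * ((if ω ∈ A then b else 0) - c))) = fun ω =>
      Real.exp (l * (0 - c)) +
        A.indicator (fun _ => Real.exp (l * (b - c)) - Real.exp (l * (0 - c))) ω := by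
    ext ω
    by_cases h : ω ∈ A <;> simp [h]
  rw [this]
  exact (integrable_const _).add ((integrable_const _).indicator hA)

theorem integral_exp_ite {A : Set Ω} [DecidablePred (· ∈ A)] (hA : MeasurableSet A) (b c l : ℝ) :
    ∫ ω, Real.exp (l * ((if ω ∈ A then b else 0) - c)) ∂P = Real.exp (l * (0 - c)) + P.real A *
      (Real.exp (l * (b - c)) - Real.exp (l * (0 - c))) := by
  have : (fun ω => Real.exp (l * ((if ω ∈ A then b else 0) - c))) = fun ω =>
      Real.exp (l * (0 - c)) +
        A.indicator (fun _ => Real.exp (l * (b - c)) - Real.exp (l * (0 - c))) ω := by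
    ext ω
    by_cases h : ω ∈ A <;> simp [h]
  rw [this, integral_add (integrable_const _) ((integrable_const _).indicator hA),
    integral_indicator_const _ hA]
  simp

/-- Independence factors the moment generating function, and `two_point_exp_moment_le` bounds each
factor. -/
theorem mgf_estAt_le (hm : ∀ n, Measurable (r n)) (hi : iIndepFun r P)
    (hu : ∀ n, pdf.IsUniform (r n) (Set.Ioo (0 : ℝ) 1) P volume) (w y : ℕ → ℝ) (N : ℕ)
    (hw : ∀ i < N, 0 < w i) (hy : ∀ i < N, 0 ≤ y i ∧ y i ≤ w i) {t l : ℝ} (ht : 0 < t)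
    (hl : |l| * t ≤ 1) :
    Integrable (fun ω => Real.exp (l * (estAt w y (fun i => w i / r i ω) N t -
      ∑ i ∈ Finset.range N, y i))) P ∧
    mgf (fun ω => estAt w y (fun i => w i / r i ω) N t - ∑ i ∈ Finset.range N, y i) P l ≤
      Real.exp (l ^ 2 * (t * ∑ i ∈ Finset.range N, w i)) := by
  classical
  let g : ℕ → ℝ → ℝ := fun i x => (if t < w i / x then y i * max 1 (t / w i) else 0) - y i
  have hS : ∀ i, MeasurableSet {x : ℝ | t < w i / x} := fun i =>
    measurableSet_lt measurable_const (measurable_const.div measurable_id)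
  have hg : ∀ i, Measurable (g i) := fun i =>
    (Measurable.ite (hS i) measurable_const measurable_const).sub_const _
  let X : ℕ → Ω → ℝ := fun i => g i ∘ r i
  have hX : iIndepFun X P := hi.comp g hg
  have hXm : ∀ i, Measurable (X i) := fun i => (hg i).comp (hm i)
  have hA : ∀ i, MeasurableSet {ω | t < w i / r i ω} := fun i => hm i (hS i)
  have hsum : (fun ω => estAt w y (fun i => w i / r i ω) N t - ∑ i ∈ Finset.range N, y i) =
      ∑ i ∈ Finset.range N, X i := by
    ext ω
    simp [estAt, X, g, Finset.sum_apply, Finset.sum_sub_distrib]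
  have hint : ∀ i, Integrable (fun ω => Real.exp (l * X i ω)) P := fun i =>
    integrable_exp_ite (hA i) _ _ _
  refine ⟨?_, ?_⟩
  · have := hX.integrable_exp_mul_sum hXm (s := Finset.range N) (t := l) fun i _ => hint i
    rw [← hsum] at this
    exact this
  · rw [hsum, hX.mgf_sum hXm, Finset.mul_sum, Finset.mul_sum, Real.exp_sum]
    refine Finset.prod_le_prod (fun i _ => mgf_nonneg) fun i hiN => ?_
    have hiN := Finset.mem_range.1 hiN
    have h1 : mgf (X i) P l = _ := integral_exp_ite (P := P) (hA i) (y i * max 1 (t / w i)) (y i) l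
    rw [h1, measureReal_priority_gt (hm i) (hu i) (hw i hiN) ht]
    exact two_point_exp_moment_le (hw i hiN) ht (hy i hiN).1 (hy i hiN).2 hl

theorem tail_estAt_ge (hm : ∀ n, Measurable (r n)) (hi : iIndepFun r P)
    (hu : ∀ n, pdf.IsUniform (r n) (Set.Ioo (0 : ℝ) 1) P volume) (w y : ℕ → ℝ) (N : ℕ)
    (hw : ∀ i < N, 0 < w i) (hy : ∀ i < N, 0 ≤ y i ∧ y i ≤ w i) {t δ : ℝ} (ht : 0 < t)
    (hδ : 0 < δ) (hδ' : δ ≤ 1) :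
    P.real {ω | δ * ∑ i ∈ Finset.range N, w i ≤
        estAt w y (fun i => w i / r i ω) N t - ∑ i ∈ Finset.range N, y i} ≤
      Real.exp (-(δ ^ 2 * (∑ i ∈ Finset.range N, w i) / (4 * t))) := by
  -- The choice `l = δ / (2t)` minimises the Chernoff exponent `l² t W - l δ W`.
  have hl : |δ / (2 * t)| * t ≤ 1 := by
    rw [abs_of_pos (by positivity)]; field_simp; linarith
  obtain ⟨h1, h2⟩ := mgf_estAt_le hm hi hu w y N hw hy ht hl
  refine (measure_ge_le_exp_mul_mgf _ (by positivity) h1).trans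
    ((mul_le_mul_of_nonneg_left h2 (Real.exp_pos _).le).trans (le_of_eq ?_))
  rw [← Real.exp_add]
  congr 1
  field_simp
  ring

theorem tail_estAt_le (hm : ∀ n, Measurable (r n)) (hi : iIndepFun r P)
    (hu : ∀ n, pdf.IsUniform (r n) (Set.Ioo (0 : ℝ) 1) P volume) (w y : ℕ → ℝ) (N : ℕ)
    (hw : ∀ i < N, 0 < w i) (hy : ∀ i < N, 0 ≤ y i ∧ y i ≤ w i) {t δ : ℝ} (ht : 0 < t)
    (hδ : 0 < δ) (hδ' : δ ≤ 1) :
    P.real {ω | estAt w y (fun i => w i / r i ω) N t - ∑ i ∈ Finset.range N, y i ≤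
        -(δ * ∑ i ∈ Finset.range N, w i)} ≤
      Real.exp (-(δ ^ 2 * (∑ i ∈ Finset.range N, w i) / (4 * t))) := by
  have hl : |-(δ / (2 * t))| * t ≤ 1 := by
    rw [abs_neg, abs_of_pos (by positivity)]; field_simp; linarith
  obtain ⟨h1, h2⟩ := mgf_estAt_le hm hi hu w y N hw hy ht hl
  refine (measure_le_le_exp_mul_mgf _ (neg_nonpos.2 (by positivity)) h1).trans
    ((mul_le_mul_of_nonneg_left h2 (Real.exp_pos _).le).trans (le_of_eq ?_))
  rw [← Real.exp_add]
  congr 1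
  field_simp
  ring

/-- Bernstein's inequality for the estimate at a fixed threshold. -/
theorem tail_abs_estAt (hm : ∀ n, Measurable (r n)) (hi : iIndepFun r P)
    (hu : ∀ n, pdf.IsUniform (r n) (Set.Ioo (0 : ℝ) 1) P volume) (w y : ℕ → ℝ) (N : ℕ)
    (hw : ∀ i < N, 0 < w i) (hy : ∀ i < N, 0 ≤ y i ∧ y i ≤ w i) {t δ : ℝ} (ht : 0 < t)
    (hδ : 0 < δ) (hδ' : δ ≤ 1) :
    P.real {ω | δ * ∑ i ∈ Finset.range N, w i ≤
        |estAt w y (fun i => w i / r i ω) N t - ∑ i ∈ Finset.range N, y i|} ≤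
      2 * Real.exp (-(δ ^ 2 * (∑ i ∈ Finset.range N, w i) / (4 * t))) := by
  have h1 := tail_estAt_ge hm hi hu w y N hw hy ht hδ hδ'
  have h2 := tail_estAt_le hm hi hu w y N hw hy ht hδ hδ'
  refine (measureReal_mono ?_).trans ((measureReal_union_le _ _).trans (add_le_add h1 h2)) |>.trans
    (le_of_eq (two_mul _).symm)
  intro ω hω
  simp only [Set.mem_ofPred_eq, Set.mem_union] at hω ⊢
  rcases le_abs.1 hω with h | h
  · exact Or.inl h
  · right; linarith

/-- It is unlikely that `s` items have a priority greater than twice the average `W / s`. -/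
theorem tail_card_priority_gt (hm : ∀ n, Measurable (r n)) (hi : iIndepFun r P)
    (hu : ∀ n, pdf.IsUniform (r n) (Set.Ioo (0 : ℝ) 1) P volume) (w : ℕ → ℝ) (N : ℕ)
    (hw : ∀ i < N, 0 < w i) (hN : 0 < N) (s : ℕ) (hs : 0 < s) :
    P.real {ω | s ≤ ((Finset.range N).filter fun i =>
        2 * (∑ i ∈ Finset.range N, w i) / s < w i / r i ω).card} ≤ Real.exp (-(s / 8)) := by
  set W := ∑ i ∈ Finset.range N, w i with hW
  have hWp : 0 < W := Finset.sum_pos (fun i h => hw i (Finset.mem_range.1 h)) (by simpa using hN.ne')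
  have hs' : (0 : ℝ) < s := by exact_mod_cast hs
  have ht : 0 < 2 * W / s := by positivity
  have h := tail_estAt_ge hm hi hu w w N hw (fun i h => ⟨(hw i h).le, le_rfl⟩) ht one_pos le_rfl
  rw [← hW] at h
  refine (measureReal_mono ?_).trans (h.trans (le_of_eq ?_))
  · intro ω hω
    simp only [Set.mem_ofPred_eq] at hω ⊢
    -- With `y = w`, each item above the threshold contributes at least `2W/s`, so `s` of them force
    -- `estAt ≥ 2W`, a deviation of `W` from the mean.
    have h1 : (2 * W / s) * ((Finset.range N).filter fun i => 2 * W / s < w i / r i ω).card ≤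
        estAt w w (fun i => w i / r i ω) N (2 * W / s) := by
      rw [mul_comm, ← nsmul_eq_mul, ← Finset.sum_const, Finset.sum_filter, estAt]
      refine Finset.sum_le_sum fun i h => ?_
      have hwi := hw i (Finset.mem_range.1 h)
      split_ifs
      · calc 2 * W / s = w i * (2 * W / s / w i) := by field_simp
          _ ≤ _ := mul_le_mul_of_nonneg_left (le_max_right _ _) hwi.le
      · exact le_rfl
    have h2 : (s : ℝ) ≤ (((Finset.range N).filter fun i => 2 * W / s < w i / r i ω).card : ℝ) := by
      exact_mod_cast hω
    have h3 := mul_le_mul_of_nonneg_left h2 ht.le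
    rw [div_mul_cancel₀ _ hs'.ne'] at h3
    linarith
  · congr 1
    field_simp
    ring

end Tail

/-! ### Measurability of the protocol's counters. -/

section Measurability

variable {Ω : Type*} [MeasurableSpace Ω] {R : ℕ → Ω → ℝ}

theorem measurable_two_pow {J : Ω → ℕ} (hJ : Measurable J) :
    Measurable fun ω => (2 : ℝ) ^ J ω :=
  (measurable_of_countable fun k : ℕ => (2 : ℝ) ^ k).comp hJ

/-- Only the first `n` priorities are assumed measurable, so that this also applies to the σ-algebra
of the past in `lintegral_potential_le`. -/
theorem measurable_rounds (s n : ℕ) (hR : ∀ i < n, Measurable (R i)) :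
    Measurable fun ω => rounds s (fun i => R i ω) n := by
  induction n with
  | zero => exact measurable_const
  | succ n ih =>
    have hJ := ih fun i hi => hR i (by omega)
    have h1 := measurable_two_pow hJ
    have h2 := measurable_two_pow (hJ.add_const 1)
    have hc : Measurable fun ω => countGE (fun i => R i ω) (n + 1)
        (2 ^ (rounds s (fun i => R i ω) n + 1)) := by
      simp only [countGE, Finset.card_filter]
      refine Finset.measurable_sum _ fun i hi => ?_
      exact Measurable.ite (measurableSet_le h2 (hR i (Finset.mem_range.1 hi)))
        measurable_const measurable_const
    simp only [rounds]
    exact Measurable.ite ((measurableSet_le h1 (hR n (by omega))).inter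
      (measurableSet_le measurable_const hc)) (hJ.add_const 1) hJ

theorem measurable_hiSends (s n : ℕ) (hR : ∀ i < n, Measurable (R i)) :
    Measurable fun ω => hiSends s (fun i => R i ω) n := by
  induction n with
  | zero => exact measurable_const
  | succ n ih =>
    have hR' : ∀ i < n, Measurable (R i) := fun i hi => hR i (by omega)
    have h2 := measurable_two_pow ((measurable_rounds s n hR').add_const 1)
    simp only [hiSends]
    exact (ih hR').add (Measurable.ite (measurableSet_le h2 (hR n (by omega)))
      measurable_const measurable_const)

theorem measurable_loSends (s n : ℕ) (hR : ∀ i < n, Measurable (R i)) :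
    Measurable fun ω => loSends s (fun i => R i ω) n := by
  induction n with
  | zero => exact measurable_const
  | succ n ih =>
    have hR' : ∀ i < n, Measurable (R i) := fun i hi => hR i (by omega)
    have h1 := measurable_two_pow (measurable_rounds s n hR')
    have h2 := measurable_two_pow ((measurable_rounds s n hR').add_const 1)
    simp only [loSends]
    exact (ih hR').add (Measurable.ite ((measurableSet_le h1 (hR n (by omega))).inter
      (measurableSet_lt (hR n (by omega)) h2)) measurable_const measurable_const)

end Measurability

/-! ### The supermartingale comparing the two queues. -/

open scoped ENNReal

/-- The factor by which the potential changes when an item of priority `x` arrives in round `j`. -/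
def potentialFactor (j : ℕ) (x : ℝ) : ℝ≥0∞ :=
  if (2 : ℝ) ^ (j + 1) ≤ x then 1 / 2 else if (2 : ℝ) ^ j ≤ x then 3 / 2 else 1

/-- A supermartingale that compares the numbers of arrivals in the two queues. -/
def potential (s : ℕ) (ρ : ℕ → ℝ) (n : ℕ) : ℝ≥0∞ :=
  (3 / 2) ^ loSends s ρ n * (1 / 2) ^ hiSends s ρ n

theorem potential_succ (s : ℕ) (ρ : ℕ → ℝ) (n : ℕ) :
    potential s ρ (n + 1) = potential s ρ n * potentialFactor (rounds s ρ n) (ρ n) := by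
  unfold potential potentialFactor
  rw [hiSends, loSends]
  by_cases h2 : (2 : ℝ) ^ (rounds s ρ n + 1) ≤ ρ n
  · have h3 : ¬ ρ n < (2 : ℝ) ^ (rounds s ρ n + 1) := not_lt.2 h2
    simp only [h2, h3, if_true, and_false, if_false, add_zero]
    rw [pow_succ, mul_assoc]
  · have h3 : ρ n < (2 : ℝ) ^ (rounds s ρ n + 1) := not_le.1 h2
    by_cases h1 : (2 : ℝ) ^ rounds s ρ n ≤ ρ n
    · simp only [h1, h2, h3, if_true, and_self, if_false, add_zero]
      rw [pow_succ, mul_right_comm]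
    · simp [h1, h2]

theorem measurable_potentialFactor (j : ℕ) : Measurable (potentialFactor j) :=
  Measurable.ite measurableSet_Ici measurable_const
    (Measurable.ite measurableSet_Ici measurable_const measurable_const)

theorem measurable_potential {Ω : Type*} [MeasurableSpace Ω] {R : ℕ → Ω → ℝ} (s n : ℕ)
    (hR : ∀ i < n, Measurable (R i)) : Measurable fun ω => potential s (fun i => R i ω) n :=
  ((measurable_of_countable fun k : ℕ => (3 / 2 : ℝ≥0∞) ^ k).comp (measurable_loSends s n hR)).mul
    ((measurable_of_countable fun k : ℕ => (1 / 2 : ℝ≥0∞) ^ k).comp (measurable_hiSends s n hR))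

theorem measurable_ite_rounds_potential {Ω : Type*} [MeasurableSpace Ω] {R : ℕ → Ω → ℝ} (s n j : ℕ)
    (hR : ∀ i < n, Measurable (R i)) : Measurable fun ω =>
      if rounds s (fun i => R i ω) n = j then potential s (fun i => R i ω) n else 0 :=
  Measurable.ite (measurable_rounds s n hR (measurableSet_singleton j))
    (measurable_potential s n hR) measurable_const

section Supermartingale

variable {Ω : Type*} [MeasurableSpace Ω] {P : Measure Ω} [IsProbabilityMeasure P] {R : ℕ → Ω → ℝ}

theorem lintegral_potentialFactor_le {X : Ω → ℝ} (hX : Measurable X) (j : ℕ)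
    (h : P.real {ω | (2 : ℝ) ^ j ≤ X ω} ≤ 2 * P.real {ω | (2 : ℝ) ^ (j + 1) ≤ X ω}) :
    ∫⁻ ω, potentialFactor j (X ω) ∂P ≤ 1 := by
  set A := {ω | (2 : ℝ) ^ j ≤ X ω} with hAdef
  set B := {ω | (2 : ℝ) ^ (j + 1) ≤ X ω} with hBdef
  have hA : MeasurableSet A := hX measurableSet_Ici
  have hB : MeasurableSet B := hX measurableSet_Ici
  have hBA : B ⊆ A := fun ω hω => two_pow_rounds_le _ _ hω
  -- Integrated, this says that the mean factor is `1 + P(A)/2 - P(B)`; it is kept additive because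
  -- subtraction in `ℝ≥0∞` truncates.
  have e : ∀ ω, potentialFactor j (X ω) + B.indicator (fun _ => 1) ω =
      1 + A.indicator (fun _ => 1 / 2) ω := by
    intro ω
    have h32 : (3 / 2 : ℝ≥0∞) = 1 + 1 / 2 := by
      rw [show (3 : ℝ≥0∞) = 2 + 1 by norm_num, ENNReal.add_div,
        ENNReal.div_self (by simp) (by simp)]
    by_cases h2 : ω ∈ B
    · have h2' : (2 : ℝ) ^ (j + 1) ≤ X ω := h2
      rw [Set.indicator_of_mem h2, Set.indicator_of_mem (hBA h2), potentialFactor, if_pos h2',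
        add_comm]
    · have h2' : ¬ (2 : ℝ) ^ (j + 1) ≤ X ω := h2
      rw [Set.indicator_of_notMem h2, potentialFactor, if_neg h2']
      by_cases h1 : ω ∈ A
      · have h1' : (2 : ℝ) ^ j ≤ X ω := h1
        rw [Set.indicator_of_mem h1, if_pos h1', h32, add_zero]
      · have h1' : ¬ (2 : ℝ) ^ j ≤ X ω := h1
        rw [Set.indicator_of_notMem h1, if_neg h1']
  have e2 := lintegral_congr (μ := P) e
  have hφ : Measurable fun ω => potentialFactor j (X ω) := (measurable_potentialFactor j).comp hX
  rw [lintegral_add_left hφ,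
    lintegral_add_left measurable_const, lintegral_indicator_const hB,
    lintegral_indicator_const hA, lintegral_one, measure_univ, one_mul] at e2
  have h3 : 1 / 2 * P A ≤ P B := by
    have h4 : P A ≤ 2 * P B := by
      rw [← ENNReal.toReal_le_toReal (measure_ne_top _ _)
        (ENNReal.mul_ne_top (by simp) (measure_ne_top _ _)), ENNReal.toReal_mul]
      simpa [Measure.real] using h
    calc 1 / 2 * P A ≤ 1 / 2 * (2 * P B) := by gcongr
      _ = P B := by
        rw [← mul_assoc, one_div, ENNReal.inv_mul_cancel (by simp) (by simp), one_mul]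
  have h5 : ∫⁻ ω, potentialFactor j (X ω) ∂P + P B ≤ 1 + P B :=
    e2.le.trans (add_le_add_right h3 1)
  exact (ENNReal.add_le_add_iff_right (measure_ne_top _ _)).1 h5

theorem lintegral_potential_le (hm : ∀ n, Measurable (R n)) (hi : iIndepFun R P) (s N : ℕ)
    (h : ∀ n < N, ∀ j : ℕ,
      P.real {ω | (2 : ℝ) ^ j ≤ R n ω} ≤ 2 * P.real {ω | (2 : ℝ) ^ (j + 1) ≤ R n ω}) :
    ∫⁻ ω, potential s (fun i => R i ω) N ∂P ≤ 1 := by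
  induction N with
  | zero => simp [potential, loSends, hiSends]
  | succ n ih =>
    refine le_trans ?_ (ih fun k hk => h k (by omega))
    set m : ℕ → MeasurableSpace Ω := fun i => MeasurableSpace.comap (R i) inferInstance with hmdef
    have hle : ∀ i, m i ≤ ‹MeasurableSpace Ω› := fun i => (hm i).comap_le
    have hind : Indep (⨆ i ∈ Set.Iio n, m i) (⨆ i ∈ ({n} : Set ℕ), m i) P :=
      indep_iSup_of_disjoint hle hi (by simp)
    have hR : ∀ i < n, @Measurable _ _ (⨆ i ∈ Set.Iio n, m i) _ (R i) := fun i hin =>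
      (comap_measurable (R i)).mono (le_iSup₂ (f := fun i (_ : i ∈ Set.Iio n) => m i) i hin) le_rfl
    have hRn : @Measurable _ _ (⨆ i ∈ ({n} : Set ℕ), m i) _ (R n) :=
      (comap_measurable (R n)).mono
        (le_iSup₂ (f := fun i (_ : i ∈ ({n} : Set ℕ)) => m i) n rfl) le_rfl
    -- The round number is random but determined by the past. Splitting by its value makes the next
    -- factor a function of the new priority alone, independent of `F j`.
    set F : ℕ → Ω → ℝ≥0∞ := fun j ω =>
      if rounds s (fun i => R i ω) n = j then potential s (fun i => R i ω) n else 0 with hF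
    have hFm : ∀ j, @Measurable _ _ (⨆ i ∈ Set.Iio n, m i) _ (F j) := fun j =>
      @measurable_ite_rounds_potential Ω (⨆ i ∈ Set.Iio n, m i) R s n j hR
    have hle1 : (⨆ i ∈ Set.Iio n, m i) ≤ ‹MeasurableSpace Ω› := iSup₂_le fun i _ => hle i
    have hle2 : (⨆ i ∈ ({n} : Set ℕ), m i) ≤ ‹MeasurableSpace Ω› := iSup₂_le fun i _ => hle i
    have hFm' : ∀ j, Measurable (F j) := fun j => (hFm j).mono hle1 le_rfl
    have hsum : ∀ ω (G : ℕ → ℝ≥0∞), ∑ j ∈ Finset.range (n + 1), F j ω * G j =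
        potential s (fun i => R i ω) n * G (rounds s (fun i => R i ω) n) := by
      intro ω G
      rw [Finset.sum_eq_single (rounds s (fun i => R i ω) n)]
      · simp [hF]
      · intro b _ hb
        simp [hF, hb.symm]
      · intro hb
        exact absurd (Finset.mem_range.2 (Nat.lt_succ_of_le (rounds_le s _ n))) hb
    calc ∫⁻ ω, potential s (fun i => R i ω) (n + 1) ∂P
        = ∫⁻ ω, ∑ j ∈ Finset.range (n + 1), F j ω * potentialFactor j (R n ω) ∂P := by
          refine lintegral_congr fun ω => ?_
          rw [potential_succ, hsum ω fun j => potentialFactor j (R n ω)]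
      _ = ∑ j ∈ Finset.range (n + 1), ∫⁻ ω, F j ω * potentialFactor j (R n ω) ∂P :=
          lintegral_finsetSum _ fun j _ =>
            (hFm' j).mul ((measurable_potentialFactor j).comp (hm n))
      _ ≤ ∑ j ∈ Finset.range (n + 1), ∫⁻ ω, F j ω ∂P := by
          refine Finset.sum_le_sum fun j _ => ?_
          have e : ∫⁻ ω, F j ω * potentialFactor j (R n ω) ∂P =
              (∫⁻ ω, F j ω ∂P) * ∫⁻ ω, potentialFactor j (R n ω) ∂P :=
            lintegral_mul_eq_lintegral_mul_lintegral_of_independent_measurableSpace hle1 hle2 hind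
              (hFm j) ((measurable_potentialFactor j).comp hRn)
          rw [e]
          exact mul_le_of_le_one_right' (lintegral_potentialFactor_le (hm n) j (h n (by omega) j))
      _ = ∫⁻ ω, ∑ j ∈ Finset.range (n + 1), F j ω ∂P :=
          (lintegral_finsetSum _ fun j _ => hFm' j).symm
      _ = ∫⁻ ω, potential s (fun i => R i ω) n ∂P := by
          refine lintegral_congr fun ω => ?_
          simpa using hsum ω fun _ => 1

/-- With high probability, the arrivals in the lower queue are at most about twice the arrivals in
the upper one. -/
theorem tail_loSends (hm : ∀ n, Measurable (R n)) (hi : iIndepFun R P) (s N : ℕ)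
    (h : ∀ n < N, ∀ j : ℕ,
      P.real {ω | (2 : ℝ) ^ j ≤ R n ω} ≤ 2 * P.real {ω | (2 : ℝ) ^ (j + 1) ≤ R n ω}) :
    P.real {ω | 2 * (hiSends s (fun i => R i ω) N + s) ≤ loSends s (fun i => R i ω) N} ≤
      (1 / 2) ^ s := by
  have h1 := lintegral_potential_le hm hi s N h
  have h2 := mul_meas_ge_le_lintegral (μ := P) (measurable_potential s N fun i _ => hm i)
    ((2 : ℝ≥0∞) ^ s)
  have hsub : {ω | 2 * (hiSends s (fun i => R i ω) N + s) ≤ loSends s (fun i => R i ω) N} ⊆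
      {ω | (2 : ℝ≥0∞) ^ s ≤ potential s (fun i => R i ω) N} := by
    intro ω hω
    simp only [Set.mem_ofPred_eq] at hω ⊢
    unfold potential
    generalize loSends s (fun i => R i ω) N = a at *
    generalize hiSends s (fun i => R i ω) N = b at *
    have h32 : (3 / 2 : ℝ≥0∞) = ENNReal.ofReal (3 / 2) := by
      rw [ENNReal.ofReal_div_of_pos (by norm_num)]; simp
    have h12 : (1 / 2 : ℝ≥0∞) = ENNReal.ofReal (1 / 2) := by
      rw [ENNReal.ofReal_div_of_pos (by norm_num)]; simp
    have h22 : (2 : ℝ≥0∞) = ENNReal.ofReal 2 := by simp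
    rw [h32, h12, h22, ← ENNReal.ofReal_pow (by norm_num), ← ENNReal.ofReal_pow (by norm_num),
      ← ENNReal.ofReal_pow (by norm_num), ← ENNReal.ofReal_mul (by positivity)]
    apply ENNReal.ofReal_le_ofReal
    -- Since `(3/2)² ≥ 2`, two lower-queue arrivals outweigh one upper-queue arrival; the surplus
    -- gives `2^s` for Markov's inequality.
    calc (2 : ℝ) ^ s = 2 ^ (b + s) * (1 / 2) ^ b := by
          rw [pow_add, mul_right_comm, ← mul_pow]; norm_num
      _ ≤ ((3 / 2) ^ 2) ^ (b + s) * (1 / 2) ^ b := by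
          gcongr; norm_num
      _ ≤ (3 / 2) ^ a * (1 / 2) ^ b := by
          rw [← pow_mul]
          gcongr
          norm_num
  have h3 : P {ω | 2 * (hiSends s (fun i => R i ω) N + s) ≤ loSends s (fun i => R i ω) N} ≤
      (2 ^ s)⁻¹ := by
    rw [← one_div, ENNReal.le_div_iff_mul_le (by simp) (by simp), mul_comm]
    exact (mul_le_mul_right (measure_mono hsub) _).trans (h2.trans h1)
  have h4 := ENNReal.toReal_mono (by simp) h3
  simpa [Measure.real] using h4

end Supermartingale

/-! ### Deterministic consequences of the good events. -/

/-- If fewer than `s` items exceed `t`, then a threshold reached by `s` items is at most `t`. -/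
theorem le_of_le_countGE {s N : ℕ} {ρ : ℕ → ℝ} {t u : ℝ}
    (h : ((Finset.range N).filter fun i => t < ρ i).card < s) (hu : s ≤ countGE ρ N u) : u ≤ t := by
  by_contra! hlt
  refine absurd (hu.trans (Finset.card_le_card fun i hi => ?_)) (not_le.2 h)
  simp only [Finset.mem_filter] at hi ⊢
  exact ⟨hi.1, hlt.trans_le hi.2⟩

/-- The message bound, on the event that few items are large and few items enter the lower queue. -/
theorem messages_le {m s N : ℕ} (hs : 1 ≤ s) (site : ℕ → Fin m) (ρ : ℕ → ℝ) {t b : ℝ}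
    (ht : t ≤ 2 * b) (h1 : ((Finset.range N).filter fun i => t < ρ i).card < s)
    (h2 : loSends s ρ N < 2 * (hiSends s ρ N + s)) :
    ((run s site ρ N).messages : ℝ) ≤ 14 * ((m + s) * max 1 (Real.log b)) := by
  rw [messages_run]
  have h3 := hiSends_le s hs ρ N
  set J := rounds s ρ N with hJ
  have hJl : (J : ℝ) ≤ 3 * max 1 (Real.log b) := by
    by_cases h0 : J = 0
    · rw [h0]; have := le_max_left 1 (Real.log b); simp
    · have h4 := le_of_le_countGE h1 (le_countGE_of_rounds_ne_zero s ρ N h0)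
      have h5 : (2 : ℝ) ^ J ≤ 2 * b := h4.trans ht
      have hb : 0 < b := by
        have : (0 : ℝ) < 2 ^ J := by positivity
        linarith
      have h6 := Real.log_le_log (by positivity) h5
      rw [Real.log_pow, Real.log_mul (by norm_num) hb.ne'] at h6
      have h7 := Real.log_two_gt_d9
      have h8 := Real.log_two_lt_d9
      have h9 := le_max_left 1 (Real.log b)
      have h10 := le_max_right 1 (Real.log b)
      have h11 : (0 : ℝ) ≤ J := Nat.cast_nonneg _
      nlinarith
  -- Lower arrivals cost at most `2 (hiSends + s)`, hence `3 s (J + 1) + 2 s` in all for the items;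
  -- with `J ≤ 3M`, `M ≥ 1`, this gives the constant `9 + 5 = 14`.
  have h4 : m * J + hiSends s ρ N + loSends s ρ N ≤ m * J + s * (3 * J + 5) := by
    have e : s * (3 * J + 5) = 3 * (s * (J + 1)) + 2 * s := by ring
    omega
  have h5 : ((m * J + hiSends s ρ N + loSends s ρ N : ℕ) : ℝ) ≤ m * J + s * (3 * J + 5) := by
    exact_mod_cast h4
  refine h5.trans ?_
  have h9 := le_max_left 1 (Real.log b)
  set M := max 1 (Real.log b)
  have hm0 : (0 : ℝ) ≤ m := Nat.cast_nonneg _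
  have hs0 : (0 : ℝ) ≤ s := Nat.cast_nonneg _
  have e1 : (m : ℝ) * J ≤ m * (14 * M) := mul_le_mul_of_nonneg_left (by linarith) hm0
  have e2 : (s : ℝ) * (3 * J + 5) ≤ s * (14 * M) := mul_le_mul_of_nonneg_left (by linarith) hs0
  linarith

/-- Raising the threshold can only lose items, and the weight of a survivor grows by a factor of at
most `c`. -/
theorem estAt_le_mul_estAt {w y ρ : ℕ → ℝ} {N : ℕ} (hw : ∀ i < N, 0 < w i)
    (hy : ∀ i < N, 0 ≤ y i) {t u c : ℝ} (ht : 0 < t) (htu : t ≤ u) (hu : u ≤ c * t) :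
    estAt w y ρ N u ≤ c * estAt w y ρ N t := by
  have hc : 1 ≤ c := by
    by_contra! h
    nlinarith
  unfold estAt
  rw [Finset.mul_sum]
  refine Finset.sum_le_sum fun i hi => ?_
  have hwi := hw i (Finset.mem_range.1 hi)
  have hyi := hy i (Finset.mem_range.1 hi)
  have hmax : max 1 (u / w i) ≤ c * max 1 (t / w i) := by
    apply max_le
    · have := le_max_left 1 (t / w i); nlinarith
    · calc u / w i ≤ c * t / w i := by gcongr
        _ = c * (t / w i) := mul_div_assoc _ _ _
        _ ≤ _ := mul_le_mul_of_nonneg_left (le_max_right _ _) (by linarith)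
  by_cases h1 : u < ρ i
  · rw [if_pos h1, if_pos (htu.trans_lt h1)]
    calc y i * max 1 (u / w i) ≤ y i * (c * max 1 (t / w i)) := mul_le_mul_of_nonneg_left hmax hyi
      _ = _ := by ring
  · rw [if_neg h1]
    have : 0 ≤ max 1 (t / w i) := zero_le_one.trans (le_max_left _ _)
    split_ifs <;> positivity

/-- Accuracy on a geometric grid of thresholds gives accuracy at all thresholds below its top. -/
theorem abs_estAt_sub_le_of_grid {w y ρ : ℕ → ℝ} {N : ℕ} (hw : ∀ i < N, 0 < w i)
    (hy : ∀ i < N, 0 ≤ y i ∧ y i ≤ w i) {t t₀ ε : ℝ} (hε : 0 < ε) (hε1 : ε ≤ 1)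
    (ht : 0 < t) (htt : t ≤ t₀)
    (hgrid : ∀ k : ℕ, |estAt w y ρ N (t₀ / (1 + ε / 3) ^ k) - ∑ i ∈ Finset.range N, y i| <
      ε / 3 * ∑ i ∈ Finset.range N, w i) :
    |estAt w y ρ N t - ∑ i ∈ Finset.range N, y i| ≤ ε * ∑ i ∈ Finset.range N, w i := by
  have hq : (1 : ℝ) < 1 + ε / 3 := by linarith
  -- The threshold is sandwiched between consecutive grid points; each one-sided comparison costs a
  -- factor `1 + ε/3`.
  obtain ⟨k, hk1, hk2⟩ := exists_nat_pow_near ((one_le_div ht).2 htt) hq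
  have hqk : 0 < (1 + ε / 3) ^ k := by positivity
  have hy0 : ∀ i < N, 0 ≤ y i := fun i h => (hy i h).1
  have hk2' : t₀ / (1 + ε / 3) ^ (k + 1) ≤ t := by
    rw [div_lt_iff₀ ht] at hk2
    rw [div_le_iff₀ (by positivity)]; linarith
  have hk1' : t ≤ t₀ / (1 + ε / 3) ^ k := by
    rw [le_div_iff₀ ht] at hk1
    rw [le_div_iff₀ hqk]; linarith
  have hee : (1 + ε / 3) * (t₀ / (1 + ε / 3) ^ (k + 1)) = t₀ / (1 + ε / 3) ^ k := by
    rw [pow_succ]; field_simp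
  have hup := estAt_le_mul_estAt (ρ := ρ) hw hy0 (t := t₀ / (1 + ε / 3) ^ (k + 1)) (u := t)
    (c := 1 + ε / 3) (by have := ht.trans_le htt; positivity) hk2' (by rw [hee]; exact hk1')
  have hlo := estAt_le_mul_estAt (ρ := ρ) hw hy0 (t := t) (u := t₀ / (1 + ε / 3) ^ k)
    (c := 1 + ε / 3) ht hk1' (by
      rw [← hee]; exact mul_le_mul_of_nonneg_left hk2' (by linarith))
  have hYW : ∑ i ∈ Finset.range N, y i ≤ ∑ i ∈ Finset.range N, w i :=
    Finset.sum_le_sum fun i h => (hy i (Finset.mem_range.1 h)).2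
  have hY : 0 ≤ ∑ i ∈ Finset.range N, y i :=
    Finset.sum_nonneg fun i h => hy0 i (Finset.mem_range.1 h)
  have g1 := (abs_lt.1 (hgrid k)).1
  have g2 := (abs_lt.1 (hgrid (k + 1))).2
  set W := ∑ i ∈ Finset.range N, w i
  set Y := ∑ i ∈ Finset.range N, y i
  have hW : 0 ≤ W := hY.trans hYW
  have hεW : ε * ε * W ≤ ε * W := by
    have := mul_le_mul_of_nonneg_right hε1 (mul_nonneg hε.le hW)
    linarith
  have hεW0 : 0 ≤ ε * W := by positivity
  have hεY : ε * Y ≤ ε * W := mul_le_mul_of_nonneg_left hYW hε.le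
  rw [abs_le]
  constructor
  · have h : (1 + ε / 3) * (Y - ε * W) ≤ (1 + ε / 3) * estAt w y ρ N t := by
      have : 0 ≤ ε * ε * W := by positivity
      nlinarith
    have := le_of_mul_le_mul_left h (by linarith)
    linarith
  · nlinarith

/-! ### From matrices to threshold estimates. -/

section Matrices

variable {d : ℕ}

/-- The squared length of the projection of the rows on the line spanned by `x`. -/
def sqProj (a : ℕ → EuclideanSpace ℝ (Fin d)) (x : EuclideanSpace ℝ (Fin d)) (i : ℕ) : ℝ :=
  (∑ j, a i j * x j) ^ 2

theorem sqProj_le (a : ℕ → EuclideanSpace ℝ (Fin d)) {x : EuclideanSpace ℝ (Fin d)} (hx : ‖x‖ = 1)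
    (i : ℕ) : sqProj a x i ≤ ‖a i‖ ^ 2 := by
  have h := Finset.sum_mul_sq_le_sq_mul_sq Finset.univ (fun j => a i j) (fun j => x j)
  rw [← EuclideanSpace.real_norm_sq_eq, ← EuclideanSpace.real_norm_sq_eq, hx] at h
  simpa [sqProj] using h

theorem sqNormMulVec_streamMatrix (a : ℕ → EuclideanSpace ℝ (Fin d)) (N : ℕ)
    (x : EuclideanSpace ℝ (Fin d)) :
    sqNormMulVec (streamMatrix a N) x = ∑ i ∈ Finset.range N, sqProj a x i := by
  unfold sqNormMulVec
  rw [EuclideanSpace.real_norm_sq_eq, Finset.sum_range]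
  rfl

theorem norm_streamMatrix_sq (a : ℕ → EuclideanSpace ℝ (Fin d)) (N : ℕ) :
    ‖streamMatrix a N‖ ^ 2 = ∑ i ∈ Finset.range N, ‖a i‖ ^ 2 := by
  rw [Matrix.frobenius_norm_def, ← Real.sqrt_eq_rpow, Real.sq_sqrt (by positivity),
    Finset.sum_range]
  refine Finset.sum_congr rfl fun i _ => ?_
  rw [EuclideanSpace.norm_sq_eq]
  simp [streamMatrix]

theorem sqNormMulVec_estimate (s : ℕ) (a : ℕ → EuclideanSpace ℝ (Fin d)) (ρ : ℕ → ℝ)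
    (T : Finset ℕ) (x : EuclideanSpace ℝ (Fin d)) :
    sqNormMulVec (estimate s a ρ T) x =
      ∑ i ∈ kept s ρ T, scale s ρ T (‖a i‖ ^ 2) ^ 2 * sqProj a x i := by
  unfold sqNormMulVec
  rw [EuclideanSpace.real_norm_sq_eq, ← Finset.sum_coe_sort (kept s ρ T)]
  refine Finset.sum_congr rfl fun i _ => ?_
  simp only [estimate, Matrix.mulVec, dotProduct, Matrix.of_apply, sqProj]
  rw [← mul_pow, Finset.mul_sum]
  simp only [mul_assoc]

theorem minPriority_eq (ρ : ℕ → ℝ) {T : Finset ℕ} (h : T.Nonempty) :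
    minPriority ρ T = T.inf' h ρ := dif_pos h

/-- All items above `ρ̂` are held because `u ≤ ρ̂`, so nothing depends on how `u` arose. The last
conclusion serves to bound `ρ̂` by `t₀`. Ties in priority do no harm. -/
theorem sqNormMulVec_estimate_of_le {s N : ℕ} (hs : 1 ≤ s) (a : ℕ → EuclideanSpace ℝ (Fin d))
    (ρ : ℕ → ℝ) (u : ℝ) (x : EuclideanSpace ℝ (Fin d)) (hw : ∀ i < N, 0 < ‖a i‖ ^ 2)
    (hT : s ≤ countGE ρ N u) :
    sqNormMulVec (estimate s a ρ ((Finset.range N).filter fun i => u ≤ ρ i)) x =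
      estAt (fun i => ‖a i‖ ^ 2) (sqProj a x) ρ N
        (minPriority ρ ((Finset.range N).filter fun i => u ≤ ρ i)) ∧
    u ≤ minPriority ρ ((Finset.range N).filter fun i => u ≤ ρ i) ∧
    s ≤ countGE ρ N (minPriority ρ ((Finset.range N).filter fun i => u ≤ ρ i)) := by
  have hTs : ¬ ((Finset.range N).filter fun i => u ≤ ρ i).card < s := not_lt.2 hT
  have hne : ((Finset.range N).filter fun i => u ≤ ρ i).Nonempty :=
    Finset.card_pos.1 (by omega)
  have hu : u ≤ minPriority ρ ((Finset.range N).filter fun i => u ≤ ρ i) := by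
    rw [minPriority_eq ρ hne]
    exact Finset.le_inf' _ _ fun i hi => (Finset.mem_filter.1 hi).2
  refine ⟨?_, hu, hT.trans (Finset.card_le_card fun i hi => ?_)⟩
  · rw [sqNormMulVec_estimate, kept, if_neg hTs]
    set p := minPriority ρ ((Finset.range N).filter fun i => u ≤ ρ i)
    have hf : (((Finset.range N).filter fun i => u ≤ ρ i).filter fun i => p < ρ i) =
        (Finset.range N).filter fun i => p < ρ i := by
      rw [Finset.filter_filter]
      exact Finset.filter_congr fun i _ => ⟨fun h => h.2, fun h => ⟨hu.trans h.le, h⟩⟩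
    rw [hf, Finset.sum_filter, estAt]
    refine Finset.sum_congr rfl fun i hi => ?_
    have hwi := hw i (Finset.mem_range.1 hi)
    split_ifs
    · rw [scale, if_neg hTs, Real.sq_sqrt (div_nonneg (hwi.le.trans (le_max_left _ _)) hwi.le),
        mul_comm, ← div_self hwi.ne', max_div_div_right hwi.le]
    · rfl
  · refine Finset.mem_filter.2 ⟨(Finset.mem_filter.1 hi).1, ?_⟩
    rw [minPriority_eq ρ hne]
    exact Finset.inf'_le _ hi

/-- If fewer than `s` items are held, then the whole stream is held. -/
theorem sqNormMulVec_estimate_of_lt {s N : ℕ} (a : ℕ → EuclideanSpace ℝ (Fin d))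
    (ρ : ℕ → ℝ) (x : EuclideanSpace ℝ (Fin d)) (hρ : ∀ i < N, 1 ≤ ρ i)
    (hT : countGE ρ N (2 ^ rounds s ρ N) < s) :
    sqNormMulVec (estimate s a ρ
      ((Finset.range N).filter fun i => (2 : ℝ) ^ rounds s ρ N ≤ ρ i)) x =
      ∑ i ∈ Finset.range N, sqProj a x i := by
  have hJ : rounds s ρ N = 0 := by
    by_contra h
    exact absurd (le_countGE_of_rounds_ne_zero s ρ N h) (not_le.2 hT)
  have hT' : ((Finset.range N).filter fun i => (2 : ℝ) ^ rounds s ρ N ≤ ρ i).card < s := hT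
  rw [sqNormMulVec_estimate, kept, if_pos hT']
  simp only [scale, if_pos hT', one_pow, one_mul]
  rw [hJ, pow_zero, Finset.filter_true_of_mem fun i hi => hρ i (Finset.mem_range.1 hi)]

/-- The accuracy of the coordinator's matrix, on the event that few items are large and the
estimates on a grid of thresholds are accurate. -/
theorem abs_sqNormMulVec_sub_le {m s N : ℕ} (hs : 1 ≤ s) (a : ℕ → EuclideanSpace ℝ (Fin d))
    (site : ℕ → Fin m) (r : ℕ → ℝ) {x : EuclideanSpace ℝ (Fin d)} (hx : ‖x‖ = 1)
    (hw : ∀ i < N, 0 < ‖a i‖ ^ 2) {ε t₀ : ℝ} (hε : 0 < ε) (hε1 : ε ≤ 1)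
    (hρ : ∀ i < N, 1 ≤ priority a r i)
    (hc : ((Finset.range N).filter fun i => t₀ < priority a r i).card < s)
    (hgrid : ∀ k : ℕ, |estAt (fun i => ‖a i‖ ^ 2) (sqProj a x) (priority a r) N
      (t₀ / (1 + ε / 3) ^ k) - ∑ i ∈ Finset.range N, sqProj a x i| <
      ε / 3 * ∑ i ∈ Finset.range N, ‖a i‖ ^ 2) :
    |sqNormMulVec (streamMatrix a N) x - sqNormMulVec (coordMatrix s a site r N) x| ≤
      ε * ‖streamMatrix a N‖ ^ 2 := by
  rw [sqNormMulVec_streamMatrix, norm_streamMatrix_sq, coordMatrix, sample_run]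
  rcases lt_or_ge (countGE (priority a r) N (2 ^ rounds s (priority a r) N)) s with h | h
  · rw [sqNormMulVec_estimate_of_lt a _ x hρ h, sub_self, abs_zero]
    exact mul_nonneg hε.le (Finset.sum_nonneg fun i _ => sq_nonneg _)
  · obtain ⟨h1, h2, h3⟩ := sqNormMulVec_estimate_of_le hs a _ _ x hw h
    rw [h1, abs_sub_comm]
    have hpos : (0 : ℝ) < 2 ^ rounds s (priority a r) N := by positivity
    exact abs_estAt_sub_le_of_grid hw (fun i _ => ⟨sq_nonneg _, sqProj_le a hx i⟩) hε hε1
      (hpos.trans_le h2) (le_of_le_countGE hc h3) hgrid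

end Matrices

/-! ### Probabilities of the bad events. -/

section Events

variable {Ω : Type*} [MeasurableSpace Ω] {P : Measure Ω} [IsProbabilityMeasure P] {r : ℕ → Ω → ℝ}

theorem one_sub_le_measureReal_of_compl_subset {S B : Set Ω} {p : ℝ} (h : Sᶜ ⊆ B)
    (hB : P.real B ≤ p) : 1 - p ≤ P.real S := by
  have h1 : P.real (Set.univ : Set Ω) ≤ P.real S + P.real B := by
    refine (measureReal_mono ?_).trans (measureReal_union_le S B)
    intro ω _
    by_cases hω : ω ∈ S
    · exact Or.inl hω
    · exact Or.inr (h hω)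
  rw [probReal_univ] at h1
  linarith

/-- A countable union bound with geometrically decreasing probabilities. -/
theorem measureReal_iUnion_le_geometric {B : ℕ → Set Ω} {b q : ℝ} (hb : 0 ≤ b) (hq : 0 ≤ q)
    (hq1 : q < 1) (h : ∀ k, P.real (B k) ≤ b * q ^ k) : P.real (⋃ k, B k) ≤ b * (1 - q)⁻¹ := by
  have hs : HasSum (fun k : ℕ => b * q ^ k) (b * (1 - q)⁻¹) :=
    (hasSum_geometric_of_lt_one hq hq1).mul_left b
  have h1 : P (⋃ k, B k) ≤ ENNReal.ofReal (b * (1 - q)⁻¹) := by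
    rw [← hs.tsum_eq, ENNReal.ofReal_tsum_of_nonneg (fun k => by positivity) hs.summable]
    refine (measure_iUnion_le B).trans (ENNReal.tsum_le_tsum fun k => ?_)
    rw [← ofReal_measureReal]
    exact ENNReal.ofReal_le_ofReal (h k)
  have h2 : 0 ≤ b * (1 - q)⁻¹ := mul_nonneg hb (inv_nonneg.2 (by linarith))
  have h3 := ENNReal.toReal_mono ENNReal.ofReal_ne_top h1
  rwa [ENNReal.toReal_ofReal h2] at h3

theorem inv_one_sub_exp_neg_le {z : ℝ} (hz : 0 < z) : (1 - Real.exp (-z))⁻¹ ≤ 1 + 1 / z := by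
  have h1 := Real.add_one_le_exp z
  have h2 : Real.exp (-z) ≤ 1 / (z + 1) := by
    rw [Real.exp_neg, ← one_div]
    exact one_div_le_one_div_of_le (by linarith) h1
  have h3 : z / (z + 1) ≤ 1 - Real.exp (-z) := by
    have : z / (z + 1) = 1 - 1 / (z + 1) := by field_simp; ring
    linarith
  calc (1 - Real.exp (-z))⁻¹ ≤ (z / (z + 1))⁻¹ := inv_anti₀ (by positivity) h3
    _ = 1 + 1 / z := by field_simp

/-- The estimates are accurate on the whole grid of thresholds with high probability. -/
theorem tail_grid (hm : ∀ n, Measurable (r n)) (hi : iIndepFun r P)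
    (hu : ∀ n, pdf.IsUniform (r n) (Set.Ioo (0 : ℝ) 1) P volume) (w y : ℕ → ℝ) (N : ℕ)
    (hw : ∀ i < N, 0 < w i) (hy : ∀ i < N, 0 ≤ y i ∧ y i ≤ w i) (hN : 0 < N) {s : ℕ} (hs : 0 < s)
    {δ : ℝ} (hδ : 0 < δ) (hδ1 : δ ≤ 1) :
    P.real (⋃ k : ℕ, {ω | δ * ∑ i ∈ Finset.range N, w i ≤
      |estAt w y (fun i => w i / r i ω) N
        (2 * (∑ i ∈ Finset.range N, w i) / s / (1 + δ) ^ k) - ∑ i ∈ Finset.range N, y i|}) ≤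
      2 * Real.exp (-(δ ^ 2 * s / 8)) * (1 + 1 / (δ ^ 2 * s / 8 * δ)) := by
  have hWp : 0 < ∑ i ∈ Finset.range N, w i :=
    Finset.sum_pos (fun i h => hw i (Finset.mem_range.1 h)) (by simpa using hN.ne')
  have hs' : (0 : ℝ) < s := by exact_mod_cast hs
  set A := δ ^ 2 * s / 8 with hA
  have hAp : 0 < A := by positivity
  refine (measureReal_iUnion_le_geometric (b := 2 * Real.exp (-A)) (q := Real.exp (-(A * δ)))
    (by positivity) (Real.exp_pos _).le (Real.exp_lt_one_iff.2 (by simp; positivity)) ?_).trans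
    (mul_le_mul_of_nonneg_left (inv_one_sub_exp_neg_le (by positivity)) (by positivity))
  intro k
  refine (tail_abs_estAt hm hi hu w y N hw hy (by positivity) hδ hδ1).trans ?_
  rw [mul_assoc, ← Real.exp_nat_mul, ← Real.exp_add]
  refine mul_le_mul_of_nonneg_left (Real.exp_le_exp.2 ?_) zero_le_two
  have e : δ ^ 2 * (∑ i ∈ Finset.range N, w i) /
      (4 * (2 * (∑ i ∈ Finset.range N, w i) / s / (1 + δ) ^ k)) = A * (1 + δ) ^ k := by
    rw [hA]; field_simp; ring
  rw [e]
  -- Bernoulli's inequality turns the growing exponents `A (1 + δ)^k` into a geometric series of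
  -- ratio `exp (-(A δ))`.
  have h1 := one_add_mul_le_pow (show (-2 : ℝ) ≤ δ by linarith) k
  have h2 := mul_le_mul_of_nonneg_left h1 hAp.le
  linarith

theorem tail_lower_queue (hm : ∀ n, Measurable (r n)) (hi : iIndepFun r P)
    (hu : ∀ n, pdf.IsUniform (r n) (Set.Ioo (0 : ℝ) 1) P volume) (w : ℕ → ℝ) (N s : ℕ)
    (hw : ∀ i < N, 0 < w i) :
    P.real {ω | 2 * (hiSends s (fun i => w i / r i ω) N + s) ≤
      loSends s (fun i => w i / r i ω) N} ≤ (1 / 2) ^ s := by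
  refine tail_loSends (R := fun i ω => w i / r i ω) (fun n => (hm n).const_div _)
    (hi.comp (fun i x => w i / x) fun i => measurable_id.const_div _) s N fun n hn j => ?_
  have hwn := hw n hn
  rw [measureReal_priority_ge (hm n) (hu n) hwn (by positivity),
    measureReal_priority_ge (hm n) (hu n) hwn (by positivity)]
  -- Doubling the threshold at most halves `min 1 (w/t)`.
  have e : 2 * (w n / 2 ^ (j + 1)) = w n / 2 ^ j := by rw [pow_succ]; field_simp
  rw [mul_min_of_nonneg _ _ zero_le_two, e]
  exact min_le_min (by norm_num) le_rfl

end Events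

/-! ### Numerical estimates. -/

theorem half_pow_le_exp (s : ℕ) : (1 / 2 : ℝ) ^ s ≤ Real.exp (-(s / 8)) := by
  have h : (1 / 2 : ℝ) ≤ Real.exp (-(1 / 2)) := by
    have := Real.add_one_le_exp (-(1 / 2) : ℝ); linarith
  calc (1 / 2 : ℝ) ^ s ≤ Real.exp (-(1 / 2)) ^ s := pow_le_pow_left₀ (by norm_num) h s
    _ = Real.exp (s * (-(1 / 2))) := (Real.exp_nat_mul _ _).symm
    _ ≤ _ := Real.exp_le_exp.2 (by have : (0 : ℝ) ≤ s := Nat.cast_nonneg s; linarith)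

theorem exp_add_half_pow_le {s : ℕ} (hs : 1024 ≤ (s : ℝ)) :
    Real.exp (-(s / 8)) + (1 / 2 : ℝ) ^ s ≤ Real.exp (-(1 / 16) * s) := by
  have h1 := half_pow_le_exp s
  have h2 : Real.exp (-((s : ℝ) / 8)) = Real.exp (-(1 / 16) * s) * Real.exp (-(1 / 16) * s) := by
    rw [← Real.exp_add]; congr 1; ring
  have h3 : Real.exp (-(1 / 16) * (s : ℝ)) ≤ 1 / 2 := by
    have h4 := Real.add_one_le_exp ((1 / 16 : ℝ) * s)
    rw [show -(1 / 16) * (s : ℝ) = -((1 / 16 : ℝ) * s) by ring, Real.exp_neg, ← one_div]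
    exact one_div_le_one_div_of_le (by norm_num) (by linarith)
  have h4 := Real.exp_pos (-(1 / 16) * (s : ℝ))
  nlinarith

/-- The quadratic term `(s/16)²/2 = s²/512` of the exponential reaches `2s` at `s = 1024`. -/
theorem exp_neg_le_inv {s : ℕ} (hs : 1024 ≤ (s : ℝ)) :
    Real.exp (-(1 / 16) * s) ≤ 1 / (2 * s) := by
  have h4 := Real.quadratic_le_exp_of_nonneg (show 0 ≤ (1 / 16 : ℝ) * s by positivity)
  rw [show -(1 / 16) * (s : ℝ) = -((1 / 16 : ℝ) * s) by ring, Real.exp_neg, ← one_div]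
  exact one_div_le_one_div_of_le (by linarith) (by nlinarith)

/-- The sample size is large compared with its logarithm. -/
theorem log_le_sq_mul_of_sample_size {ε s : ℝ} (hε : 0 < ε)
    (hs : 2000000 * (1 / ε ^ 2 * max 1 (Real.log (1 / ε))) ≤ s) :
    288 * Real.log s ≤ ε ^ 2 * s := by
  set M := max 1 (Real.log (1 / ε)) with hM
  have hM1 : 1 ≤ M := le_max_left _ _
  have hM2 : Real.log (1 / ε) ≤ M := le_max_right _ _
  have hv : 2000000 * M ≤ ε ^ 2 * s := by
    have := mul_le_mul_of_nonneg_left hs (sq_nonneg ε)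
    have e : ε ^ 2 * (2000000 * (1 / ε ^ 2 * M)) = 2000000 * M := by field_simp
    linarith
  set v := ε ^ 2 * s with hvdef
  have hv0 : 0 < v := by linarith
  have hsv : Real.log s = Real.log v + 2 * Real.log (1 / ε) := by
    have : s = v * (1 / ε) ^ 2 := by rw [hvdef]; field_simp
    rw [this, Real.log_mul hv0.ne' (by positivity), Real.log_pow]
    norm_num
  -- Both parts of `288 log s` must be at most `v/2`; for `log v ≤ 2√v` this means `√v ≥ 1152`.
  have hq : 1152 ≤ Real.sqrt v := Real.le_sqrt_of_sq_le (by linarith)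
  have hlogv : Real.log v ≤ 2 * Real.sqrt v := by
    have h1 := Real.log_le_sub_one_of_pos (Real.sqrt_pos.2 hv0)
    rw [Real.log_sqrt hv0.le] at h1
    linarith
  have hvv := Real.mul_self_sqrt hv0.le
  nlinarith

/-- The numerical bound on the failure probability of the grid estimates. -/
theorem grid_failure_le {ε : ℝ} {s : ℕ} (hε : 0 < ε) (hε1 : ε ≤ 1)
    (hs : 2000000 * (1 / ε ^ 2 * max 1 (Real.log (1 / ε))) ≤ (s : ℝ)) :
    2 * Real.exp (-((ε / 3) ^ 2 * s / 8)) * (1 + 1 / ((ε / 3) ^ 2 * s / 8 * (ε / 3))) ≤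
      1 / (2 * s) := by
  have hlog := log_le_sq_mul_of_sample_size hε hs
  have hM1 : 1 ≤ max 1 (Real.log (1 / ε)) := le_max_left _ _
  have h1 : 2000000 ≤ ε ^ 2 * s := by
    have h := mul_le_mul_of_nonneg_left hs (sq_nonneg ε)
    have e : ε ^ 2 * (2000000 * (1 / ε ^ 2 * max 1 (Real.log (1 / ε)))) =
      2000000 * max 1 (Real.log (1 / ε)) := by field_simp
    linarith
  have hs0 : (0 : ℝ) < s := by
    by_contra! h
    nlinarith [sq_nonneg ε]
  have h2 : 1 ≤ ε * s := by nlinarith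
  have hs1 : 2000000 ≤ (s : ℝ) := by nlinarith
  -- The exponent is `ε² s / 72`, so the fourth power is what the constant `288 = 4 · 72` provides.
  have h3 : Real.exp (-((ε / 3) ^ 2 * s / 8)) ≤ 1 / (s : ℝ) ^ 4 := by
    rw [Real.exp_neg, ← one_div]
    apply one_div_le_one_div_of_le (by positivity)
    rw [← Real.log_le_iff_le_exp (by positivity), Real.log_pow]
    push_cast
    linarith
  have h4 : 1 / ((ε / 3) ^ 2 * s / 8 * (ε / 3)) ≤ s := by
    rw [div_le_iff₀ (by positivity)]
    nlinarith
  calc 2 * Real.exp (-((ε / 3) ^ 2 * s / 8)) * (1 + 1 / ((ε / 3) ^ 2 * s / 8 * (ε / 3)))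
      ≤ 2 * (1 / (s : ℝ) ^ 4) * (1 + (s : ℝ)) := by gcongr
    _ ≤ 1 / (2 * (s : ℝ)) := by
      rw [mul_one_div, div_mul_eq_mul_div, div_le_div_iff₀ (by positivity) (by positivity)]
      have h5 : (8 : ℝ) ≤ s ^ 2 := by nlinarith
      have h6 := mul_le_mul_of_nonneg_right h5 (sq_nonneg (s : ℝ))
      nlinarith

end PrioritySampling

end

/-! ### Assembly of the theorem. -/

open PrioritySampling in
theorem theorem5 :
    ∃ C₀ C c : ℝ, 0 < C₀ ∧ 0 < C ∧ 0 < c ∧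
      ∀ (ε : ℝ) (_ : 0 < ε) (_ : ε ≤ 1)
        (s : ℕ) (_ : C₀ * (1 / ε ^ 2 * max 1 (Real.log (1 / ε))) ≤ (s : ℝ))
        (m d N : ℕ) (β : ℝ)
        (a : ℕ → EuclideanSpace ℝ (Fin d)) (site : ℕ → Fin m)
        (_ : ∀ n < N, 1 ≤ ‖a n‖ ^ 2 ∧ ‖a n‖ ^ 2 ≤ β)
        (Ω : Type*) (_ : MeasurableSpace Ω) (P : Measure Ω) (_ : IsProbabilityMeasure P)
        (r : ℕ → Ω → ℝ) (_ : ∀ n, Measurable (r n)) (_ : iIndepFun r P)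
        (_ : ∀ n, pdf.IsUniform (r n) (Set.Ioo (0 : ℝ) 1) P volume),
        1 - Real.exp (-c * s) ≤
            P.real {ω | (messageCount s a site (fun n => r n ω) N : ℝ) ≤
              C * ((m + s) * max 1 (Real.log (β * N / s)))} ∧
        ∀ x : EuclideanSpace ℝ (Fin d), ‖x‖ = 1 →
          1 - 1 / (s : ℝ) ≤
            P.real {ω |
              (messageCount s a site (fun n => r n ω) N : ℝ) ≤
                C * ((m + s) * max 1 (Real.log (β * N / s))) ∧
              |sqNormMulVec (streamMatrix a N) x -
                  sqNormMulVec (coordMatrix s a site (fun n => r n ω) N) x| ≤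
                ε * ‖streamMatrix a N‖ ^ 2} := by
  refine ⟨2000000, 14, 1 / 16, by norm_num, by norm_num, by norm_num, ?_⟩
  intro ε hε hε1 s hs m d N β a site hw Ω _ P _ r hm hi hu
  have hs1 : 2000000 ≤ (s : ℝ) := by
    have h1 : 1 ≤ max 1 (Real.log (1 / ε)) := le_max_left _ _
    have h2 : 1 ≤ 1 / ε ^ 2 := by
      rw [one_le_div (by positivity)]; exact pow_le_one₀ hε.le hε1
    nlinarith
  have hs0 : (0 : ℝ) < s := by linarith
  have hsN : 1 ≤ s := by exact_mod_cast (show (1 : ℝ) ≤ s by linarith)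
  have hw0 : ∀ i < N, 0 < ‖a i‖ ^ 2 := fun i h => one_pos.trans_le (hw i h).1
  set t₀ := 2 * (∑ i ∈ Finset.range N, ‖a i‖ ^ 2) / s with ht₀
  have ht₀b : t₀ ≤ 2 * (β * N / s) := by
    have h : ∑ i ∈ Finset.range N, ‖a i‖ ^ 2 ≤ N * β := by
      simpa using Finset.sum_le_card_nsmul (Finset.range N) (fun i => ‖a i‖ ^ 2) β
        fun i hi => (hw i (Finset.mem_range.1 hi)).2
    rw [ht₀, mul_div_assoc, mul_comm β]
    gcongr
  set E₁ := {ω | s ≤ ((Finset.range N).filter fun i =>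
    t₀ < ‖a i‖ ^ 2 / r i ω).card} with hE₁
  set E₂ := {ω | 2 * (hiSends s (fun i => ‖a i‖ ^ 2 / r i ω) N + s) ≤
    loSends s (fun i => ‖a i‖ ^ 2 / r i ω) N} with hE₂
  have hmsg : ∀ ω, ω ∉ E₁ → ω ∉ E₂ → (messageCount s a site (fun n => r n ω) N : ℝ) ≤
      14 * ((m + s) * max 1 (Real.log (β * N / s))) := fun ω h1 h2 =>
    messages_le hsN site _ ht₀b (not_le.1 h1) (not_le.1 h2)
  have hP₁ : P.real E₁ ≤ Real.exp (-(s / 8)) := by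
    rcases Nat.eq_zero_or_pos N with rfl | hN
    · have : E₁ = ∅ := by
        ext ω; simp [hE₁]; omega
      rw [this, measureReal_empty]; positivity
    · exact tail_card_priority_gt hm hi hu _ N hw0 hN s hsN
  have hP₂ : P.real E₂ ≤ (1 / 2) ^ s := tail_lower_queue hm hi hu _ N s hw0
  have hP : P.real (E₁ ∪ E₂) ≤ Real.exp (-(1 / 16) * s) :=
    (measureReal_union_le _ _).trans
      ((add_le_add hP₁ hP₂).trans (exp_add_half_pow_le (by linarith)))
  refine ⟨one_sub_le_measureReal_of_compl_subset ?_ hP, fun x hx => ?_⟩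
  · intro ω hω
    by_contra h
    exact hω (hmsg ω (fun h1 => h (Or.inl h1)) fun h2 => h (Or.inr h2))
  set E₃ := ⋃ k : ℕ, {ω | ε / 3 * ∑ i ∈ Finset.range N, ‖a i‖ ^ 2 ≤
      |estAt (fun i => ‖a i‖ ^ 2) (sqProj a x) (fun i => ‖a i‖ ^ 2 / r i ω) N
        (t₀ / (1 + ε / 3) ^ k) - ∑ i ∈ Finset.range N, sqProj a x i|} with hE₃
  -- Off this null set all priorities of the first `N` rows are at least `1`, so before any round
  -- ends the whole stream is held.
  set E₄ := {ω | ¬ ∀ n, r n ω ∈ Set.Ioo (0 : ℝ) 1} with hE₄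
  have hP₄ : P.real E₄ = 0 := by
    have h : ∀ᵐ ω ∂P, ∀ n, r n ω ∈ Set.Ioo (0 : ℝ) 1 :=
      ae_all_iff.2 fun n => ae_mem_Ioo_of_isUniform (hm n) (hu n)
    rw [Measure.real, ae_iff.1 h, ENNReal.toReal_zero]
  rcases Nat.eq_zero_or_pos N with rfl | hN
  -- For the empty stream the non-strict inequality defining `E₃` reads `0 ≤ 0` and `E₃` is
  -- everything, so this case is separate.
  · refine one_sub_le_measureReal_of_compl_subset (B := E₁ ∪ E₂) ?_ (hP.trans
      ((exp_neg_le_inv (by linarith)).trans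
        (one_div_le_one_div_of_le hs0 (by linarith))))
    intro ω hω
    by_contra h
    refine hω ⟨hmsg ω (fun h1 => h (Or.inl h1)) fun h2 => h (Or.inr h2), ?_⟩
    rw [sqNormMulVec_streamMatrix, norm_streamMatrix_sq, coordMatrix, sqNormMulVec_estimate,
      sample_run]
    simp [kept]
  · have hP₃ : P.real E₃ ≤ 1 / (2 * s) :=
      (tail_grid hm hi hu (fun i => ‖a i‖ ^ 2) (sqProj a x) N hw0
        (fun i _ => ⟨sq_nonneg _, sqProj_le a hx i⟩) hN hsN (by positivity) (by linarith)).trans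
        (grid_failure_le hε hε1 hs)
    refine one_sub_le_measureReal_of_compl_subset (B := (E₁ ∪ E₂) ∪ (E₃ ∪ E₄)) ?_ ?_
    · intro ω hω
      by_contra h
      simp only [Set.mem_union, not_or] at h
      obtain ⟨⟨h1, h2⟩, h3, h4⟩ := h
      have h4' : ∀ n, r n ω ∈ Set.Ioo (0 : ℝ) 1 := not_not.1 h4
      refine hω ⟨hmsg ω h1 h2, abs_sqNormMulVec_sub_le hsN a site (fun n => r n ω) hx hw0 hε hε1
        (t₀ := t₀) (fun i hiN => ?_) (not_le.1 h1) fun k => ?_⟩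
      · rw [priority, one_le_div (h4' i).1]
        exact (h4' i).2.le.trans (hw i hiN).1
      · exact not_le.1 fun hk => h3 (Set.mem_iUnion.2 ⟨k, hk⟩)
    · have h1 := measureReal_union_le (μ := P) (E₁ ∪ E₂) (E₃ ∪ E₄)
      have h2 := measureReal_union_le (μ := P) E₃ E₄
      have h3 := exp_neg_le_inv (s := s) (by linarith)
      have e : 1 / (s : ℝ) = 1 / (2 * s) + 1 / (2 * s) := by field_simp; norm_num
      linarith
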